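/- **Theorem 3.1.** A *2-colored Rogers–Ramanujan partition* of an integer $n\ge 0$ is a partition of $n$ into positive parts, each colored black or red, such that any two parts of the same color differ by at least $2$ and no integer occurs as a part in both colors. Let $R_3(n)$ be the number of 2-colored Rogers–Ramanujan partitions of $n$ in which there is no red part equal to $1$. An *overpartition* of $n$ is a partition $n=d_1+d_2+\cdots+d_s$, $d_1\ge d_2\ge\cdots\ge d_s\ge 1$, in which the first occurrence of each integer may be overlined. Let $D_{2,1}(n)$ be the number of overpartitions of $n$ in which $1$ does not occur as a non-overlined part and in which, for all $1\le j<s$, $d_j-d_{j+1}\ge 1$ if $d_j$ is overlined and $d_j-d_{j+1}\ge 2$ otherwise. For complex $a,q$ with $|q|<1$ put $(a;q)_\infty=\lim_{n\to\infty}\prod_{i=0}^{n-1}(1-aq^i)$, $(a)_\infty=(a;q)_\infty$ and $(a_1,a_2,a_3;q)_\infty=(a_1;q)_\infty(a_2;q)_\infty(a_3;q)_\infty$. Then $$R_3(n)=D_{2,1}(n)\quad\text{for all } n\ge 0,$$ and for every complex $q$ with $|q|<1$ $$\sum_{n\ge 0}R_3(n)q^n=\frac{(-q)_\infty\,(q,q^3,q^4;q^4)_\infty}{(q)_\infty},$$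 the series being absolutely convergent. -/

import Mathlib

open Filter Topology

/-- A 2-colored Rogers-Ramanujan partition of `n`: positive black parts and positive red parts with
total sum `n`, such that parts of the same color differ by at least two, and no integer is both a
black and a red part. Parts of one color are in particular distinct, so each color is a finite set. -/
@[ext]
structure TwoColoredRRPartition (n : ℕ) where
  black : Finset ℕ
  red : Finset ℕ
  black_pos : ∀ x ∈ black, 0 < x
  red_pos : ∀ x ∈ red, 0 < x
  black_gap : ∀ x ∈ black, ∀ y ∈ black, x < y → x + 2 ≤ y
  red_gap : ∀ x ∈ red, ∀ y ∈ red, x < y → x + 2 ≤ y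
  disjoint : Disjoint black red
  sum_eq : ∑ x ∈ black, x + ∑ x ∈ red, x = n

/-- The number of 2-colored Rogers-Ramanujan partitions of `n` without a red `1`. -/
noncomputable def rrCountNoRedOne (n : ℕ) : ℕ :=
  Nat.card {π : TwoColoredRRPartition n // 1 ∉ π.red}

/-- An overpartition of `n`: a partition of `n`, written as a weakly decreasing sequence of positive
integers, in which the first occurrence of each integer may be overlined. An entry `(d, true)` is an
overlined `d`, an entry `(d, false)` is a non-overlined `d`. -/
@[ext]
structure Overpartition (n : ℕ) where
  parts : List (ℕ × Bool)
  pos : ∀ p ∈ parts, 0 < p.1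
  sorted : parts.IsChain (fun p r => r.1 < p.1 ∨ (r.1 = p.1 ∧ r.2 = false))
  sum_eq : (parts.map Prod.fst).sum = n

/-- The conditions defining the overpartitions `d_1 + ⋯ + d_s` counted by `D_{k,a}(n)`: `1` occurs
non-overlined at most `a - 1` times, and `d_j - d_{j+k-1}` is at least `1` if `d_j` is overlined and
at least `2` otherwise. -/
def Overpartition.IsLovejoy {n : ℕ} (k a : ℕ) (π : Overpartition n) : Prop :=
  π.parts.count (1, false) ≤ a - 1 ∧
    ∀ (j : ℕ) (h : j + (k - 1) < π.parts.length),
      if π.parts[j].2 = true then π.parts[j + (k - 1)].1 + 1 ≤ π.parts[j].1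
      else π.parts[j + (k - 1)].1 + 2 ≤ π.parts[j].1

/-- `D_{k,a}(n)`, for `k ≥ a ≥ 1`. -/
noncomputable def lovejoyD (k a n : ℕ) : ℕ :=
  Nat.card {π : Overpartition n // π.IsLovejoy k a}

/-- `(a; q)_n = ∏_{i=0}^{n-1} (1 - a q^i)`. -/
def qPochhammer (a q : ℂ) (n : ℕ) : ℂ := ∏ i ∈ Finset.range n, (1 - a * q ^ i)

/-- `(a; q)_∞ = lim_{n → ∞} (a; q)_n`. -/
noncomputable def qPochhammerInf (a q : ℂ) : ℂ := limUnder atTop (qPochhammer a q)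

/-- The limit defining `(a; q)_∞` exists for `|q| < 1`. -/
theorem tendsto_qPochhammer (a : ℂ) {q : ℂ} (hq : ‖q‖ < 1) :
    Tendsto (qPochhammer a q) atTop (𝓝 (qPochhammerInf a q)) := by
  have hs : Summable (fun i : ℕ => ‖-(a * q ^ i)‖) := by
    simpa only [norm_neg, norm_mul, norm_pow] using
      (summable_geometric_of_lt_one (norm_nonneg q) hq).mul_left ‖a‖
  have hm := (multipliable_one_add_of_summable hs).hasProd.tendsto_prod_nat
  exact tendsto_nhds_limUnder
    ⟨_, hm.congr fun n => by simp only [qPochhammer, sub_eq_add_neg]⟩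

/-! Both sides consist of sets of distinct positive integers with a two-valued colour on each part;
`true` means red on one side and overlined on the other. List the parts in decreasing order and
append a virtual 0 of colour `true`. A part at distance at least 2 from the next smaller one is
coloured freely; at distance 1 its colour is forced: opposite to that of the next part
(alternating), or `true` (spaced). The virtual 0 excludes a red 1 and a plain 1 respectively.
Recolouring the forced parts is therefore a bijection preserving sizes.

For the product, let A_N be the generating function of spaced lists with parts at most N, and let
L(x,z) = ∑ x^n q^{n(n+1)/2} (-zq;q)_n/(q;q)_n. The three-term recurrences of A_N and of L(q^k,1) are
adjoint, so a bilinear combination of them does not depend on N (`spacedGF_mul_lebesgueSeries`);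
letting N tend to infinity gives lim A_N = L(1,1). Lebesgue's identity evaluates L(1,1): L(1,z) =
(1+zq^2) L(1,zq^2) reduces z = 1 to z = 0, where Euler's L(1,0) = (-q)_∞ applies. Regrouping
infinite products finishes the proof. -/

/-! ### The recolouring bijection -/

/-- Coloured parts in decreasing order such that consecutive integers have opposite colours,
where `0` counts as a part of colour `true`. -/
def IsAlternating : List (ℕ × Bool) → Prop
  | [] => True
  | p :: l => (l.headD (0, true)).1 < p.1 ∧
      ((l.headD (0, true)).1 + 1 = p.1 → p.2 = !(l.headD (0, true)).2) ∧ IsAlternating l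

/-- Coloured parts in decreasing order such that a part following its predecessor immediately has
colour `true`, where `0` counts as a part. -/
def IsSpaced : List (ℕ × Bool) → Prop
  | [] => True
  | p :: l => (l.headD (0, true)).1 < p.1 ∧
      ((l.headD (0, true)).1 + 1 = p.1 → p.2 = true) ∧ IsSpaced l

/-- Recolours an alternating list to a spaced one. -/
def toSpaced : List (ℕ × Bool) → List (ℕ × Bool)
  | [] => []
  | p :: l => (p.1, if (l.headD (0, true)).1 + 1 = p.1 then true else p.2) :: toSpaced l

/-- Recolours a spaced list to an alternating one. -/
def toAlternating : List (ℕ × Bool) → List (ℕ × Bool)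
  | [] => []
  | p :: l => (p.1, if (l.headD (0, true)).1 + 1 = p.1 then
      !((toAlternating l).headD (0, true)).2 else p.2) :: toAlternating l

theorem headD_toSpaced (l : List (ℕ × Bool)) :
    ((toSpaced l).headD (0, true)).1 = (l.headD (0, true)).1 := by
  cases l <;> rfl

theorem headD_toAlternating (l : List (ℕ × Bool)) :
    ((toAlternating l).headD (0, true)).1 = (l.headD (0, true)).1 := by
  cases l <;> rfl

theorem isSpaced_toSpaced {l : List (ℕ × Bool)} (h : IsAlternating l) :
    IsSpaced (toSpaced l) := by
  induction l with
  | nil => trivial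
  | cons p l ih =>
    obtain ⟨h1, -, h3⟩ := h
    exact ⟨by rwa [headD_toSpaced], fun e => if_pos (by rwa [headD_toSpaced] at e), ih h3⟩

theorem isAlternating_toAlternating {l : List (ℕ × Bool)} (h : IsSpaced l) :
    IsAlternating (toAlternating l) := by
  induction l with
  | nil => trivial
  | cons p l ih =>
    obtain ⟨h1, -, h3⟩ := h
    exact ⟨by rwa [headD_toAlternating], fun e => if_pos (by rwa [headD_toAlternating] at e),
      ih h3⟩

/-- Only forced colours are overwritten, and alternation recovers them from the tail. -/
theorem toAlternating_toSpaced {l : List (ℕ × Bool)} (h : IsAlternating l) :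
    toAlternating (toSpaced l) = l := by
  induction l with
  | nil => rfl
  | cons p l ih =>
    obtain ⟨-, h2, h3⟩ := h
    rw [toSpaced, toAlternating, ih h3, headD_toSpaced]
    refine congrArg₂ _ (Prod.ext rfl ?_) rfl
    dsimp only
    split_ifs with h
    exacts [(h2 h).symm, rfl]

theorem toSpaced_toAlternating {l : List (ℕ × Bool)} (h : IsSpaced l) :
    toSpaced (toAlternating l) = l := by
  induction l with
  | nil => rfl
  | cons p l ih =>
    obtain ⟨-, h2, h3⟩ := h
    rw [toAlternating, toSpaced, ih h3, headD_toAlternating]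
    refine congrArg₂ _ (Prod.ext rfl ?_) rfl
    dsimp only
    split_ifs with h
    exacts [(h2 h).symm, rfl]

theorem map_fst_toSpaced (l : List (ℕ × Bool)) : (toSpaced l).map Prod.fst = l.map Prod.fst := by
  induction l with
  | nil => rfl
  | cons p l ih => rw [toSpaced, List.map_cons, List.map_cons, ih]

/-- Alternating lists with sum `n` correspond to spaced lists with sum `n`. -/
def alternatingEquivSpaced (n : ℕ) :
    {l : List (ℕ × Bool) // IsAlternating l ∧ (l.map Prod.fst).sum = n} ≃
      {l : List (ℕ × Bool) // IsSpaced l ∧ (l.map Prod.fst).sum = n} where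
  toFun l := ⟨toSpaced l, isSpaced_toSpaced l.2.1, by rw [map_fst_toSpaced]; exact l.2.2⟩
  invFun l := ⟨toAlternating l, isAlternating_toAlternating l.2.1, by
    rw [← map_fst_toSpaced, toSpaced_toAlternating l.2.1]; exact l.2.2⟩
  left_inv l := Subtype.ext (toAlternating_toSpaced l.2.1)
  right_inv l := Subtype.ext (toSpaced_toAlternating l.2.1)

/-! ### Overpartitions and Rogers–Ramanujan partitions as coloured lists -/

/-- The right side keeps `1 - 1` and `2 - 1` so that it matches `IsLovejoy 2 1` definitionally. -/
theorem isSpaced_iff (l : List (ℕ × Bool)) :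
    IsSpaced l ↔ (∀ p ∈ l, 0 < p.1) ∧
      l.IsChain (fun p r => r.1 < p.1 ∨ (r.1 = p.1 ∧ r.2 = false)) ∧
      l.count (1, false) ≤ 1 - 1 ∧ ∀ (j : ℕ) (h : j + (2 - 1) < l.length),
        if l[j].2 = true then l[j + (2 - 1)].1 + 1 ≤ l[j].1
        else l[j + (2 - 1)].1 + 2 ≤ l[j].1 := by
  induction l with
  | nil => simp [IsSpaced]
  | cons p l ih =>
    rw [IsSpaced, ih]
    have hsplit (P : ℕ → Prop) : (∀ j, P j) ↔ P 0 ∧ ∀ j, P (j + 1) :=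
      ⟨fun h => ⟨h 0, fun j => h _⟩, fun h j => by cases j; exacts [h.1, h.2 _]⟩
    rw [hsplit (fun j => ∀ h : j + (2 - 1) < (p :: l).length, _)]
    obtain ⟨d, c⟩ := p
    cases l with
    | nil => cases c <;> simp [List.count_singleton]; omega
    | cons r l =>
      obtain ⟨d', c'⟩ := r
      cases c <;> simp [List.count_cons] <;> grind

/-- The overpartitions counted by `D_{2,1}(n)` are the spaced lists with sum `n`. -/
def lovejoyEquivSpaced (n : ℕ) :
    {π : Overpartition n // π.IsLovejoy 2 1} ≃
      {l : List (ℕ × Bool) // IsSpaced l ∧ (l.map Prod.fst).sum = n} where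
  toFun π := ⟨π.1.parts, (isSpaced_iff _).2 ⟨π.1.pos, π.1.sorted, π.2⟩, π.1.sum_eq⟩
  invFun l := ⟨⟨l.1, ((isSpaced_iff _).1 l.2.1).1, ((isSpaced_iff _).1 l.2.1).2.1, l.2.2⟩,
    ((isSpaced_iff _).1 l.2.1).2.2⟩
  left_inv _ := rfl
  right_inv _ := rfl

/-- Two parts differing by 1 are neighbours in a decreasing list, so the gap condition within each
colour only constrains adjacent entries. -/
theorem isAlternating_iff (l : List (ℕ × Bool)) :
    IsAlternating l ↔ l.Pairwise (fun p r => r.1 < p.1) ∧ (∀ p ∈ l, 0 < p.1) ∧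
      (1, true) ∉ l ∧ ∀ c x y, (x, c) ∈ l → (y, c) ∈ l → x < y → x + 2 ≤ y := by
  induction l with
  | nil => simp [IsAlternating]
  | cons p l ih =>
    rw [IsAlternating, ih]
    obtain ⟨d, c⟩ := p
    cases l with
    | nil => cases c <;> simp
    | cons r l =>
      obtain ⟨d', c'⟩ := r
      simp only [List.headD_cons, List.pairwise_cons, List.mem_cons, forall_eq_or_imp, not_or,
        Prod.mk.injEq]
      constructor
      · rintro ⟨h1, h2, ⟨h3, h4⟩, ⟨h5, h6⟩, ⟨h7, h8⟩, h9⟩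
        refine ⟨⟨⟨h1, fun a ha => (h3 a ha).trans h1⟩, h3, h4⟩, ⟨by omega, h5, h6⟩,
          ⟨by omega, h7, h8⟩, ?_⟩
        grind
      · rintro ⟨⟨⟨h1, -⟩, h3, h4⟩, ⟨-, h5, h6⟩, ⟨-, h7, h8⟩, h9⟩
        refine ⟨h1, fun e => ?_, ⟨h3, h4⟩, ⟨h5, h6⟩, ⟨h7, h8⟩, fun b x y hx hy =>
          h9 b x y (.inr hx) (.inr hy)⟩
        by_contra hne
        obtain rfl : c = c' := by cases c <;> cases c' <;> simp at hne ⊢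
        have := h9 c d' d (.inr (.inl ⟨rfl, rfl⟩)) (.inl ⟨rfl, rfl⟩) h1
        omega

theorem eq_of_pairwise_fst_lt {l l' : List (ℕ × Bool)}
    (h : l.Pairwise (fun p r => r.1 < p.1)) (h' : l'.Pairwise (fun p r => r.1 < p.1))
    (hmem : ∀ p, p ∈ l ↔ p ∈ l') : l = l' := by
  have nd {m : List (ℕ × Bool)} (hm : m.Pairwise (fun p r => r.1 < p.1)) : m.Nodup :=
    hm.imp fun hlt e => by rw [e] at hlt; exact lt_irrefl _ hlt
  exact ((List.perm_ext_iff_of_nodup (nd h) (nd h')).2 hmem).eq_of_pairwise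
    (fun a b _ _ h1 h2 => absurd h1 h2.asymm) h h'

/-- The parts of one colour in a list of coloured parts. -/
def colorClass (c : Bool) (l : List (ℕ × Bool)) : Finset ℕ :=
  ((l.filter fun p => p.2 == c).map Prod.fst).toFinset

theorem mem_colorClass {c : Bool} {l : List (ℕ × Bool)} {x : ℕ} :
    x ∈ colorClass c l ↔ (x, c) ∈ l := by
  simp [colorClass]

/-- The decreasing list of the elements of two sets, coloured by membership in the second. -/
def coloredSort (b r : Finset ℕ) : List (ℕ × Bool) :=
  ((b ∪ r).sort (· ≥ ·)).map fun d => (d, decide (d ∈ r))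

theorem pairwise_coloredSort (b r : Finset ℕ) :
    (coloredSort b r).Pairwise (fun p r => r.1 < p.1) := by
  rw [coloredSort, List.pairwise_map]
  exact (b ∪ r).sortedGT_sort.pairwise

theorem mem_coloredSort {b r : Finset ℕ} (h : Disjoint b r) {x : ℕ} {c : Bool} :
    (x, c) ∈ coloredSort b r ↔ x ∈ if c then r else b := by
  have := @Finset.disjoint_left _ b r
  cases c <;> simp [coloredSort] <;> grind

theorem disjoint_colorClass {l : List (ℕ × Bool)} (h : l.Pairwise (fun p r => r.1 < p.1)) :
    Disjoint (colorClass false l) (colorClass true l) := by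
  rw [Finset.disjoint_left]
  intro x hf ht
  rw [mem_colorClass] at hf ht
  induction l with
  | nil => simp at hf
  | cons p l ih =>
    rw [List.pairwise_cons] at h
    rw [List.mem_cons] at hf ht
    rcases hf with rfl | hf <;> rcases ht with e | ht
    · simp at e
    · exact absurd (h.1 _ ht) (lt_irrefl x)
    · subst e; exact absurd (h.1 _ hf) (lt_irrefl x)
    · exact ih h.2 hf ht

theorem coloredSort_colorClass {l : List (ℕ × Bool)} (h : l.Pairwise (fun p r => r.1 < p.1)) :
    coloredSort (colorClass false l) (colorClass true l) = l := by
  refine eq_of_pairwise_fst_lt (pairwise_coloredSort _ _) h fun ⟨x, c⟩ => ?_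
  rw [mem_coloredSort (disjoint_colorClass h)]
  cases c <;> simp [mem_colorClass]

theorem sum_coloredSort {b r : Finset ℕ} (h : Disjoint b r) :
    ((coloredSort b r).map Prod.fst).sum = ∑ x ∈ b, x + ∑ x ∈ r, x := by
  have e : (coloredSort b r).map Prod.fst = (b ∪ r).sort (· ≥ ·) := by
    rw [coloredSort, List.map_map]; exact List.map_id _
  rw [e, ← Finset.sum_union h, ← Multiset.sum_coe, Finset.sort_eq]
  exact congrArg Multiset.sum (Multiset.map_id _).symm

theorem isAlternating_coloredSort {n : ℕ} (π : TwoColoredRRPartition n) (h : 1 ∉ π.red) :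
    IsAlternating (coloredSort π.black π.red) := by
  refine (isAlternating_iff _).2 ⟨pairwise_coloredSort _ _, fun ⟨x, c⟩ hx => ?_, ?_,
    fun c x y hx hy => ?_⟩
  · rw [mem_coloredSort π.disjoint] at hx
    cases c
    exacts [π.black_pos x hx, π.red_pos x hx]
  · rwa [mem_coloredSort π.disjoint]
  · rw [mem_coloredSort π.disjoint] at hx hy
    cases c
    exacts [π.black_gap x hx y hy, π.red_gap x hx y hy]

/-- The 2-coloured Rogers–Ramanujan partition given by an alternating list. -/
def TwoColoredRRPartition.ofList {n : ℕ} (l : List (ℕ × Bool)) (h : IsAlternating l)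
    (hs : (l.map Prod.fst).sum = n) : TwoColoredRRPartition n where
  black := colorClass false l
  red := colorClass true l
  black_pos x hx := ((isAlternating_iff l).1 h).2.1 _ (mem_colorClass.1 hx)
  red_pos x hx := ((isAlternating_iff l).1 h).2.1 _ (mem_colorClass.1 hx)
  black_gap x hx y hy :=
    ((isAlternating_iff l).1 h).2.2.2 _ x y (mem_colorClass.1 hx) (mem_colorClass.1 hy)
  red_gap x hx y hy :=
    ((isAlternating_iff l).1 h).2.2.2 _ x y (mem_colorClass.1 hx) (mem_colorClass.1 hy)
  disjoint := disjoint_colorClass ((isAlternating_iff l).1 h).1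
  sum_eq := by
    have hp := ((isAlternating_iff l).1 h).1
    rw [← sum_coloredSort (disjoint_colorClass hp), coloredSort_colorClass hp, hs]

/-- The 2-coloured Rogers–Ramanujan partitions of `n` without a red `1` are the alternating lists
with sum `n`. -/
def rrEquivAlternating (n : ℕ) :
    {π : TwoColoredRRPartition n // 1 ∉ π.red} ≃
      {l : List (ℕ × Bool) // IsAlternating l ∧ (l.map Prod.fst).sum = n} where
  toFun π := ⟨coloredSort π.1.black π.1.red, isAlternating_coloredSort π.1 π.2,
    by rw [sum_coloredSort π.1.disjoint, π.1.sum_eq]⟩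
  invFun l := ⟨.ofList l.1 l.2.1 l.2.2,
    fun h => ((isAlternating_iff l.1).1 l.2.1).2.2.1 (mem_colorClass.1 h)⟩
  left_inv π := by
    refine Subtype.ext (TwoColoredRRPartition.ext ?_ ?_) <;> ext x <;>
      exact mem_colorClass.trans (mem_coloredSort π.1.disjoint)
  right_inv l := Subtype.ext (coloredSort_colorClass ((isAlternating_iff l.1).1 l.2.1).1)

theorem rrCountNoRedOne_eq (n : ℕ) : rrCountNoRedOne n =
    Nat.card {l : List (ℕ × Bool) // IsSpaced l ∧ (l.map Prod.fst).sum = n} :=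
  Nat.card_congr ((rrEquivAlternating n).trans (alternatingEquivSpaced n))

theorem lovejoyD_eq (n : ℕ) : lovejoyD 2 1 n =
    Nat.card {l : List (ℕ × Bool) // IsSpaced l ∧ (l.map Prod.fst).sum = n} :=
  Nat.card_congr (lovejoyEquivSpaced n)

/-! ### Generating function of spaced lists -/

/-- The spaced lists with parts at most `N`. -/
def spacedLists : ℕ → Finset (List (ℕ × Bool))
  | 0 => {[]}
  | 1 => {[], [(1, true)]}
  | N + 2 => spacedLists (N + 1) ∪ ((spacedLists (N + 1)).image (List.cons (N + 2, true)) ∪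
      (spacedLists N).image (List.cons (N + 2, false)))

theorem mem_spacedLists {N : ℕ} {l : List (ℕ × Bool)} :
    l ∈ spacedLists N ↔ IsSpaced l ∧ (l.headD (0, true)).1 ≤ N := by
  induction N using Nat.twoStepInduction generalizing l with
  | zero =>
    cases l with
    | nil => simp [spacedLists, IsSpaced]
    | cons p l => simp [spacedLists, IsSpaced]; omega
  | one =>
    cases l with
    | nil => simp [spacedLists, IsSpaced]
    | cons p l =>
      obtain ⟨d, c⟩ := p
      cases l with
      | nil => simp [spacedLists, IsSpaced]; grind
      | cons r l => obtain ⟨d', c'⟩ := r; simp [spacedLists, IsSpaced]; cases l <;> simp <;> omega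
  | more N ih0 ih1 =>
    simp only [spacedLists, Finset.mem_union, Finset.mem_image, ih0, ih1]
    cases l with
    | nil => simp [IsSpaced]
    | cons p l =>
      obtain ⟨d, c⟩ := p
      simp only [List.cons.injEq, Prod.mk.injEq, IsSpaced, List.headD_cons]
      generalize hk : (l.headD (0, true)).1 = k
      cases c <;> simp <;> grind

/-- The generating function of the spaced lists with parts at most `N`. -/
def spacedGF {R : Type*} [CommSemiring R] (q : R) (N : ℕ) : R :=
  ∑ l ∈ spacedLists N, q ^ (l.map Prod.fst).sum

section
variable {R : Type*} [CommSemiring R] (q : R)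

theorem spacedGF_zero : spacedGF q 0 = 1 := by simp [spacedGF, spacedLists]

theorem spacedGF_one : spacedGF q 1 = 1 + q := by simp [spacedGF, spacedLists]

/-- Split by the head: absent N + 2, overlined N + 2 (any tail up to N + 1), or plain N + 2 (tail up
to N). -/
theorem spacedGF_add_two (N : ℕ) : spacedGF q (N + 2) =
    (1 + q ^ (N + 2)) * spacedGF q (N + 1) + q ^ (N + 2) * spacedGF q N := by
  have h1 : Disjoint ((spacedLists (N + 1)).image (List.cons (N + 2, true)))
      ((spacedLists N).image (List.cons (N + 2, false))) := by
    simp [Finset.disjoint_left]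
  have h2 : Disjoint (spacedLists (N + 1))
      ((spacedLists (N + 1)).image (List.cons (N + 2, true)) ∪
        (spacedLists N).image (List.cons (N + 2, false))) := by
    rw [Finset.disjoint_left]
    intro l hl hl'
    rw [mem_spacedLists] at hl
    rw [Finset.mem_union, Finset.mem_image, Finset.mem_image] at hl'
    obtain ⟨m, -, rfl⟩ | ⟨m, -, rfl⟩ := hl' <;> simp at hl
  rw [spacedGF, spacedLists, Finset.sum_union h2, Finset.sum_union h1,
    Finset.sum_image List.cons_injective.injOn, Finset.sum_image List.cons_injective.injOn]
  simp only [List.map_cons, List.sum_cons, pow_add _ (N + 2), ← Finset.mul_sum]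
  change spacedGF q (N + 1) + (_ * spacedGF q (N + 1) + _ * spacedGF q N) = _
  ring

end

theorem spacedLists_mono : Monotone spacedLists := fun _ _ h _ hl =>
  mem_spacedLists.2 ⟨(mem_spacedLists.1 hl).1, (mem_spacedLists.1 hl).2.trans h⟩

theorem headD_le_sum (l : List (ℕ × Bool)) : (l.headD (0, true)).1 ≤ (l.map Prod.fst).sum := by
  cases l <;> simp

/-- By monotonicity in N, the recurrence costs at most a factor 1 + 2r^{N+2} per step; the factor at
i = 0 is slack. -/
theorem spacedGF_le_prod {r : ℝ} (h0 : 0 ≤ r) (N : ℕ) :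
    spacedGF r N ≤ ∏ i ∈ Finset.range (N + 1), (1 + 2 * r ^ i) := by
  induction N with
  | zero => simp [spacedGF_zero]
  | succ N ih =>
    rw [Finset.prod_range_succ]
    cases N with
    | zero =>
      rw [zero_add, spacedGF_one]
      simp
      linarith
    | succ N =>
      rw [spacedGF_add_two]
      have hm : spacedGF r N ≤ spacedGF r (N + 1) :=
        Finset.sum_le_sum_of_subset_of_nonneg (spacedLists_mono N.le_succ)
          fun _ _ _ => pow_nonneg h0 _
      calc _ ≤ (1 + r ^ (N + 2)) * spacedGF r (N + 1) + r ^ (N + 2) * spacedGF r (N + 1) := by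
            gcongr
        _ = spacedGF r (N + 1) * (1 + 2 * r ^ (N + 1 + 1)) := by ring
        _ ≤ _ := by gcongr

theorem spacedGF_le {r : ℝ} (h0 : 0 ≤ r) (h1 : r < 1) (N : ℕ) :
    spacedGF r N ≤ Real.exp (2 * (1 - r)⁻¹) := by
  refine (spacedGF_le_prod h0 N).trans ?_
  calc _ ≤ ∏ i ∈ Finset.range (N + 1), Real.exp (2 * r ^ i) := by
        refine Finset.prod_le_prod (fun i _ => by positivity) fun i _ => ?_
        rw [add_comm]; exact Real.add_one_le_exp _
    _ = Real.exp (2 * ∑ i ∈ Finset.range (N + 1), r ^ i) := by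
        rw [← Real.exp_sum, Finset.mul_sum]
    _ ≤ _ := by
        rw [← tsum_geometric_of_lt_one h0 h1]
        gcongr
        exact (summable_geometric_of_lt_one h0 h1).sum_le_tsum _ fun _ _ => pow_nonneg h0 _

theorem summable_spaced {q : ℂ} (hq : ‖q‖ < 1) :
    Summable fun l : {l : List (ℕ × Bool) // IsSpaced l} => q ^ (l.1.map Prod.fst).sum := by
  refine Summable.of_norm ?_
  simp only [norm_pow]
  refine summable_of_sum_le (c := Real.exp (2 * (1 - ‖q‖)⁻¹))
    (fun _ => pow_nonneg (norm_nonneg q) _) fun s => ?_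
  obtain ⟨N, hN⟩ : ∃ N, s.map (Function.Embedding.subtype _) ⊆ spacedLists N := by
    refine ⟨s.sup fun l => (l.1.map Prod.fst).sum, fun l hl => ?_⟩
    obtain ⟨m, hm, rfl⟩ := Finset.mem_map.1 hl
    exact mem_spacedLists.2 ⟨m.2, (headD_le_sum _).trans
      (Finset.le_sup (f := fun l : {l // IsSpaced l} => (l.1.map Prod.fst).sum) hm)⟩
  refine le_trans ?_ (spacedGF_le (norm_nonneg q) hq N)
  refine (Finset.sum_map s (Function.Embedding.subtype _)
    fun l : List (ℕ × Bool) => ‖q‖ ^ (l.map Prod.fst).sum).symm.trans_le ?_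
  exact Finset.sum_le_sum_of_subset_of_nonneg hN fun _ _ _ => pow_nonneg (norm_nonneg q) _

theorem tendsto_spacedGF {q : ℂ} (hq : ‖q‖ < 1) :
    Tendsto (spacedGF q) atTop
      (𝓝 (∑' l : {l : List (ℕ × Bool) // IsSpaced l}, q ^ (l.1.map Prod.fst).sum)) := by
  classical
  have hF : Tendsto (fun N => (spacedLists N).subtype IsSpaced) atTop atTop := by
    refine tendsto_atTop_finset_of_monotone (fun _ _ h => Finset.subtype_mono (spacedLists_mono h))
      fun l => ⟨(l.1.headD (0, true)).1, ?_⟩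
    exact Finset.mem_subtype.2 (mem_spacedLists.2 ⟨l.2, le_rfl⟩)
  refine ((summable_spaced hq).hasSum.comp hF).congr fun N => ?_
  exact Finset.sum_subtype_of_mem (fun l : List (ℕ × Bool) => q ^ (l.map Prod.fst).sum)
    fun l hl => (mem_spacedLists.1 hl).1

theorem finite_spaced (n : ℕ) :
    Finite {l : List (ℕ × Bool) // IsSpaced l ∧ (l.map Prod.fst).sum = n} :=
  Set.Finite.subset (spacedLists n).finite_toSet fun l (hl : IsSpaced l ∧ _) =>
    Finset.mem_coe.2 (mem_spacedLists.2 ⟨hl.1, hl.2 ▸ headD_le_sum l⟩)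

theorem hasSum_rrCountNoRedOne {q : ℂ} (hq : ‖q‖ < 1) :
    HasSum (fun n => (rrCountNoRedOne n : ℂ) * q ^ n)
      (∑' l : {l : List (ℕ × Bool) // IsSpaced l}, q ^ (l.1.map Prod.fst).sum) := by
  -- Group the absolutely convergent sum over lists by the sum of the parts.
  have hs := (Equiv.sigmaFiberEquiv fun l : {l : List (ℕ × Bool) // IsSpaced l} =>
    (l.1.map Prod.fst).sum).hasSum_iff.2 (summable_spaced hq).hasSum
  refine hs.sigma fun n => ?_
  let e := Equiv.subtypeSubtypeEquivSubtypeInter (α := List (ℕ × Bool)) IsSpaced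
    fun l => (l.map Prod.fst).sum = n
  have := finite_spaced n
  have : Finite {l : {l : List (ℕ × Bool) // IsSpaced l} // (l.1.map Prod.fst).sum = n} :=
    Finite.of_equiv _ e.symm
  have := Fintype.ofFinite {l : {l : List (ℕ × Bool) // IsSpaced l} // (l.1.map Prod.fst).sum = n}
  rw [rrCountNoRedOne_eq, ← Nat.card_congr e, Nat.card_eq_fintype_card, ← nsmul_eq_mul,
    ← Finset.card_univ, ← Finset.sum_const]
  convert hasSum_fintype _ using 1
  refine Finset.sum_congr rfl fun l _ => ?_
  change _ = q ^ (l.1.1.map Prod.fst).sum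
  rw [l.2]

/-! ### Lebesgue's identity -/

/-- The `n`-th term of Lebesgue's series
`∑ q^{n(n+1)/2} (-zq; q)_n / (q; q)_n`. -/
noncomputable def lebesgueTerm (q z : ℂ) (n : ℕ) : ℂ :=
  ∏ i ∈ Finset.range n, q ^ (i + 1) * (1 + z * q ^ (i + 1)) / (1 - q ^ (i + 1))

/-- Lebesgue's series, with an additional variable marking the index of summation. -/
noncomputable def lebesgueSeries (q x z : ℂ) : ℂ := ∑' n, x ^ n * lebesgueTerm q z n

theorem lebesgueTerm_zero (q z : ℂ) : lebesgueTerm q z 0 = 1 := by simp [lebesgueTerm]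

theorem one_sub_pow_ne_zero {q : ℂ} (hq : ‖q‖ < 1) (n : ℕ) : 1 - q ^ (n + 1) ≠ 0 := by
  intro h
  have h1 : ‖q ^ (n + 1)‖ = 1 := by rw [← sub_eq_zero.mp h, norm_one]
  rw [norm_pow] at h1
  exact (pow_lt_one₀ (norm_nonneg q) hq n.succ_ne_zero).ne h1

theorem lebesgueTerm_succ {q : ℂ} (hq : ‖q‖ < 1) (z : ℂ) (n : ℕ) :
    lebesgueTerm q z (n + 1) * (1 - q ^ (n + 1)) =
      lebesgueTerm q z n * (q ^ (n + 1) * (1 + z * q ^ (n + 1))) := by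
  have := one_sub_pow_ne_zero hq n
  rw [lebesgueTerm, Finset.prod_range_succ, ← lebesgueTerm]
  field_simp

theorem lebesgueTerm_mul (q z : ℂ) (n : ℕ) :
    lebesgueTerm q z n * (1 + z * q ^ (n + 1)) = (1 + z * q) * lebesgueTerm q (z * q) n := by
  induction n with
  | zero => simp [lebesgueTerm]
  | succ n ih =>
    have h (w : ℂ) : lebesgueTerm q w (n + 1) =
        lebesgueTerm q w n * (q ^ (n + 1) * (1 + w * q ^ (n + 1)) / (1 - q ^ (n + 1))) :=
      Finset.prod_range_succ _ n
    rw [h, h]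
    linear_combination q ^ (n + 1) * (1 + z * q ^ (n + 1 + 1)) / (1 - q ^ (n + 1)) * ih

/-- A summable bound for the terms of Lebesgue's series. -/
noncomputable def lebesgueBound (r : ℝ) (n : ℕ) : ℝ :=
  ∏ i ∈ Finset.range n, r ^ (i + 1) * 2 / (1 - r)

theorem summable_lebesgueBound {r : ℝ} (h0 : 0 ≤ r) (h1 : r < 1) :
    Summable (lebesgueBound r) := by
  -- The constant 2 / (1 - r) may be large, but the ratio of consecutive terms still tends to 0.
  have hlim : Tendsto (fun n : ℕ => r ^ (n + 1) * 2 / (1 - r)) atTop (𝓝 0) := by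
    have := (((tendsto_pow_atTop_nhds_zero_of_lt_one h0 h1).comp
      (tendsto_add_atTop_nat 1)).mul_const 2).div_const (1 - r)
    simpa using this
  refine summable_of_ratio_norm_eventually_le (r := 1 / 2) (by norm_num) ?_
  filter_upwards [hlim.eventually_le_const (show (0 : ℝ) < 1 / 2 by norm_num)] with n hn
  have : 0 ≤ r ^ (n + 1) * 2 / (1 - r) := by have := sub_pos.mpr h1; positivity
  rw [lebesgueBound, Finset.prod_range_succ, ← lebesgueBound, norm_mul, mul_comm,
    Real.norm_of_nonneg this]
  gcongr

theorem norm_lebesgueTerm_le {q x z : ℂ} (hq : ‖q‖ < 1) (hx : ‖x‖ ≤ 1) (hz : ‖z‖ ≤ 1) (n : ℕ) :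
    ‖x ^ n * lebesgueTerm q z n‖ ≤ lebesgueBound ‖q‖ n := by
  have hq' := sub_pos.mpr hq
  have key : ‖lebesgueTerm q z n‖ ≤ lebesgueBound ‖q‖ n := by
    rw [lebesgueTerm, lebesgueBound, norm_prod]
    refine Finset.prod_le_prod (fun _ _ => norm_nonneg _) fun i _ => ?_
    have hp : ‖q‖ ^ (i + 1) ≤ ‖q‖ := pow_le_of_le_one (norm_nonneg q) hq.le i.succ_ne_zero
    have hnum : ‖1 + z * q ^ (i + 1)‖ ≤ 2 := by
      calc ‖1 + z * q ^ (i + 1)‖ ≤ ‖(1 : ℂ)‖ + ‖z‖ * ‖q‖ ^ (i + 1) := by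
            rw [← norm_pow, ← norm_mul]; exact norm_add_le _ _
        _ ≤ 1 + 1 * 1 := by
            rw [norm_one]; gcongr; exact hp.trans hq.le
        _ = 2 := by norm_num
    have hden : 1 - ‖q‖ ≤ ‖1 - q ^ (i + 1)‖ := by
      have := norm_sub_norm_le (1 : ℂ) (q ^ (i + 1))
      rw [norm_one, norm_pow] at this
      linarith
    rw [norm_div, norm_mul, norm_pow]
    gcongr
  rw [norm_mul, norm_pow]
  calc ‖x‖ ^ n * ‖lebesgueTerm q z n‖ ≤ 1 * ‖lebesgueTerm q z n‖ := by
        gcongr; exact pow_le_one₀ (norm_nonneg x) hx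
    _ ≤ _ := by rwa [one_mul]

theorem summable_lebesgue {q x z : ℂ} (hq : ‖q‖ < 1) (hx : ‖x‖ ≤ 1) (hz : ‖z‖ ≤ 1) :
    Summable fun n => x ^ n * lebesgueTerm q z n :=
  (summable_lebesgueBound (norm_nonneg q) hq).of_norm_bounded (norm_lebesgueTerm_le hq hx hz)

theorem norm_mul_le_one {x y : ℂ} (hx : ‖x‖ ≤ 1) (hy : ‖y‖ ≤ 1) : ‖x * y‖ ≤ 1 := by
  rw [norm_mul]; exact mul_le_one₀ hx (norm_nonneg y) hy

theorem tendsto_lebesgueSeries {q x z : ℂ} {u v : ℕ → ℂ} (hq : ‖q‖ < 1)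
    (hu : ∀ n, ‖u n‖ ≤ 1) (hv : ∀ n, ‖v n‖ ≤ 1)
    (hux : Tendsto u atTop (𝓝 x)) (hvz : Tendsto v atTop (𝓝 z)) :
    Tendsto (fun n => lebesgueSeries q (u n) (v n)) atTop (𝓝 (lebesgueSeries q x z)) := by
  refine tendsto_tsum_of_dominated_convergence
    (summable_lebesgueBound (norm_nonneg q) hq) (fun k => ?_)
    (Eventually.of_forall fun n k => norm_lebesgueTerm_le hq (hu n) (hv n) k)
  refine (hux.pow k).mul (tendsto_finsetProd _ fun i _ => ?_)
  exact (((hvz.mul_const _).const_add 1).const_mul _).div_const _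

theorem lebesgueSeries_zero_left (q z : ℂ) : lebesgueSeries q 0 z = 1 := by
  rw [lebesgueSeries, tsum_eq_single 0 fun n hn => by simp [hn]]
  simp [lebesgueTerm_zero]

/-- The factor 1 - q^{n+1} produced on the left cancels the last denominator of the term of index n
+ 1. -/
theorem lebesgueSeries_sub {q x z : ℂ} (hq : ‖q‖ < 1) (hx : ‖x‖ ≤ 1) (hz : ‖z‖ ≤ 1) :
    lebesgueSeries q x z - lebesgueSeries q (x * q) z =
      x * q * lebesgueSeries q (x * q) z + z * x * q ^ 2 * lebesgueSeries q (x * q ^ 2) z := by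
  have hq2 : ‖q ^ 2‖ ≤ 1 := by rw [norm_pow]; exact pow_le_one₀ (norm_nonneg q) hq.le
  have h0 := summable_lebesgue hq hx hz
  have h1 := summable_lebesgue hq (norm_mul_le_one hx hq.le) hz
  have h2 := summable_lebesgue hq (norm_mul_le_one hx hq2) hz
  rw [lebesgueSeries, lebesgueSeries, lebesgueSeries, ← h0.tsum_sub h1,
    (h0.sub h1).tsum_eq_zero_add, ← tsum_mul_left, ← tsum_mul_left,
    ← (h1.mul_left _).tsum_add (h2.mul_left _)]
  simp only [pow_zero, sub_self, zero_add]
  congr 1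
  ext n
  linear_combination x ^ (n + 1) * lebesgueTerm_succ hq z n

theorem lebesgueSeries_add {q x z : ℂ} (hq : ‖q‖ < 1) (hx : ‖x‖ ≤ 1) (hz : ‖z‖ ≤ 1) :
    lebesgueSeries q x z + z * q * lebesgueSeries q (x * q) z =
      (1 + z * q) * lebesgueSeries q x (z * q) := by
  have h0 := summable_lebesgue hq hx hz
  have h1 := summable_lebesgue hq (norm_mul_le_one hx hq.le) hz
  rw [lebesgueSeries, lebesgueSeries, lebesgueSeries, ← tsum_mul_left, ← tsum_mul_left,
    ← h0.tsum_add (h1.mul_left _)]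
  congr 1
  ext n
  linear_combination x ^ n * lebesgueTerm_mul q z n

/-- Two shifts z → zq by `lebesgueSeries_add` introduce L(q,z) and L(q^2,z); `lebesgueSeries_sub` at
x = 1 eliminates them. -/
theorem lebesgueSeries_one_left {q z : ℂ} (hq : ‖q‖ < 1) (hz : ‖z‖ ≤ 1) :
    lebesgueSeries q 1 z = (1 + z * q ^ 2) * lebesgueSeries q 1 (z * q ^ 2) := by
  have hne : 1 + z * q ≠ 0 := by
    intro h
    have h1 : ‖z * q‖ = 1 := by
      rw [← norm_neg, ← norm_one (α := ℂ)]; congr 1; linear_combination -h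
    rw [norm_mul] at h1
    nlinarith [norm_nonneg z, norm_nonneg q]
  have e1 := lebesgueSeries_sub hq norm_one.le hz
  have e2 := lebesgueSeries_add hq norm_one.le hz
  have e3 := lebesgueSeries_add hq hq.le hz
  have e4 := lebesgueSeries_add hq norm_one.le (norm_mul_le_one hz hq.le)
  simp only [one_mul, mul_one, mul_assoc, ← sq] at e1 e2 e3 e4
  rw [← e4]
  refine mul_left_cancel₀ hne ?_
  linear_combination z * q * e1 + e2 + z * q ^ 2 * e3

theorem tendsto_pow_zero_complex {q : ℂ} (hq : ‖q‖ < 1) :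
    Tendsto (fun n : ℕ => q ^ n) atTop (𝓝 0) :=
  tendsto_pow_atTop_nhds_zero_of_norm_lt_one hq

theorem norm_pow_le_one {q : ℂ} (hq : ‖q‖ < 1) (n : ℕ) : ‖q ^ n‖ ≤ 1 := by
  rw [norm_pow]; exact pow_le_one₀ (norm_nonneg q) hq.le

/-- At z = 0 the x-recurrence is L(x,0) = (1+xq) L(xq,0); iterate until x tends to 0. -/
theorem lebesgueSeries_one_zero {q : ℂ} (hq : ‖q‖ < 1) :
    lebesgueSeries q 1 0 = qPochhammerInf (-q) q := by
  have h (n : ℕ) : qPochhammer (-q) q n * lebesgueSeries q (q ^ n) 0 = lebesgueSeries q 1 0 := by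
    induction n with
    | zero => simp [qPochhammer]
    | succ n ih =>
      have e := lebesgueSeries_sub hq (norm_pow_le_one hq n) (z := 0) (by simp)
      rw [← ih, qPochhammer, Finset.prod_range_succ, ← qPochhammer, pow_succ]
      linear_combination -qPochhammer (-q) q n * e
  have hlim := (tendsto_qPochhammer (-q) hq).mul (tendsto_lebesgueSeries hq (norm_pow_le_one hq)
    (fun _ => by simp) (tendsto_pow_zero_complex hq) (tendsto_const_nhds (x := (0 : ℂ))))
  simp only [h, lebesgueSeries_zero_left, mul_one] at hlim
  exact tendsto_nhds_unique tendsto_const_nhds hlim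

/-- A case of Lebesgue's identity. -/
theorem lebesgueSeries_one_one {q : ℂ} (hq : ‖q‖ < 1) :
    lebesgueSeries q 1 1 = qPochhammerInf (-q ^ 2) (q ^ 2) * qPochhammerInf (-q) q := by
  have hq2 : ‖q ^ 2‖ < 1 := by
    rw [norm_pow]; exact pow_lt_one₀ (norm_nonneg q) hq two_ne_zero
  have h (n : ℕ) : qPochhammer (-q ^ 2) (q ^ 2) n * lebesgueSeries q 1 ((q ^ 2) ^ n) =
      lebesgueSeries q 1 1 := by
    induction n with
    | zero => simp [qPochhammer]
    | succ n ih =>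
      have e := lebesgueSeries_one_left hq (norm_pow_le_one hq2 n)
      rw [← ih, qPochhammer, Finset.prod_range_succ, ← qPochhammer, pow_succ (q ^ 2) n]
      linear_combination -qPochhammer (-q ^ 2) (q ^ 2) n * e
  have hlim := (tendsto_qPochhammer (-q ^ 2) hq2).mul (tendsto_lebesgueSeries hq
    (fun _ => norm_one.le) (norm_pow_le_one hq2) (tendsto_const_nhds (x := (1 : ℂ)))
    (tendsto_pow_zero_complex hq2))
  simp only [h, lebesgueSeries_one_zero hq] at hlim
  exact tendsto_nhds_unique tendsto_const_nhds hlim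

/-! ### Regrouping infinite products -/

theorem qPochhammer_succ (a q : ℂ) (n : ℕ) :
    qPochhammer a q (n + 1) = qPochhammer a q n * (1 - a * q ^ n) :=
  Finset.prod_range_succ _ n

theorem qPochhammerInf_self_ne_zero {q : ℂ} (hq : ‖q‖ < 1) : qPochhammerInf q q ≠ 0 := by
  have hs : Summable fun i : ℕ => ‖-(q * q ^ i)‖ := by
    simpa only [norm_neg, norm_mul, norm_pow] using
      (summable_geometric_of_lt_one (norm_nonneg q) hq).mul_left ‖q‖
  have hm := (multipliable_one_add_of_summable hs).hasProd.tendsto_prod_nat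
  have heq : qPochhammerInf q q = ∏' i : ℕ, (1 + -(q * q ^ i)) :=
    tendsto_nhds_unique (tendsto_qPochhammer q hq)
      (hm.congr fun n => by simp only [qPochhammer, sub_eq_add_neg])
  rw [heq]
  refine tprod_one_add_ne_zero_of_summable (fun i => ?_) hs
  rw [← sub_eq_add_neg, ← pow_succ']
  exact one_sub_pow_ne_zero hq i

theorem tendsto_qPochhammer_comp (a : ℂ) {q : ℂ} (hq : ‖q‖ < 1) {k : ℕ} (hk : 0 < k) :
    Tendsto (fun n => qPochhammer a q (k * n)) atTop (𝓝 (qPochhammerInf a q)) :=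
  (tendsto_qPochhammer a hq).comp (tendsto_id.const_mul_atTop' hk)

/-- Exponents are sorted into 1 mod 4, 3 mod 4 and even; 4n factors on the left match n, n and 2n on
the right. -/
theorem qPochhammerInf_dissect {q : ℂ} (hq : ‖q‖ < 1) :
    qPochhammerInf q q = qPochhammerInf q (q ^ 4) * qPochhammerInf (q ^ 3) (q ^ 4) *
      qPochhammerInf (q ^ 2) (q ^ 2) := by
  have hp (k : ℕ) (hk : k ≠ 0) : ‖q ^ k‖ < 1 := by
    rw [norm_pow]; exact pow_lt_one₀ (norm_nonneg q) hq hk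
  refine tendsto_nhds_unique (tendsto_qPochhammer_comp q hq (k := 4) (by norm_num)) ?_
  refine (((tendsto_qPochhammer q (hp 4 (by norm_num))).mul
    (tendsto_qPochhammer (q ^ 3) (hp 4 (by norm_num)))).mul
    (tendsto_qPochhammer_comp (q ^ 2) (hp 2 (by norm_num)) (k := 2) (by norm_num))).congr
    fun n => ?_
  induction n with
  | zero => simp [qPochhammer]
  | succ n ih =>
    simp only [mul_add, mul_one, qPochhammer_succ,
      show 4 * n + 4 = 4 * n + 1 + 1 + 1 + 1 from rfl, show 2 * n + 2 = 2 * n + 1 + 1 from rfl,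
      ← ih]
    ring

theorem qPochhammerInf_sq {q : ℂ} (hq : ‖q‖ < 1) :
    qPochhammerInf (q ^ 2) (q ^ 2) = qPochhammerInf q q * qPochhammerInf (-q) q := by
  have hq2 : ‖q ^ 2‖ < 1 := by
    rw [norm_pow]; exact pow_lt_one₀ (norm_nonneg q) hq two_ne_zero
  refine tendsto_nhds_unique (tendsto_qPochhammer (q ^ 2) hq2) ?_
  refine ((tendsto_qPochhammer q hq).mul (tendsto_qPochhammer (-q) hq)).congr fun n => ?_
  rw [qPochhammer, qPochhammer, qPochhammer, ← Finset.prod_mul_distrib]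
  exact Finset.prod_congr rfl fun i _ => by ring

theorem lebesgueSeries_one_one_eq {q : ℂ} (hq : ‖q‖ < 1) :
    lebesgueSeries q 1 1 = qPochhammerInf (-q) q *
      (qPochhammerInf q (q ^ 4) * qPochhammerInf (q ^ 3) (q ^ 4) *
        qPochhammerInf (q ^ 4) (q ^ 4)) / qPochhammerInf q q := by
  have hq2 : ‖q ^ 2‖ < 1 := by
    rw [norm_pow]; exact pow_lt_one₀ (norm_nonneg q) hq two_ne_zero
  have h4 := qPochhammerInf_sq hq2
  rw [← pow_mul] at h4
  rw [eq_div_iff (qPochhammerInf_self_ne_zero hq), lebesgueSeries_one_one hq, h4,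
    qPochhammerInf_dissect hq]
  ring

/-! ### Comparison of the two recurrences -/

theorem spacedGF_mul_lebesgueSeries {q : ℂ} (hq : ‖q‖ < 1) (N : ℕ) :
    spacedGF q (N + 1) * lebesgueSeries q (q ^ (N + 1)) 1 +
      q ^ (N + 2) * spacedGF q N * lebesgueSeries q (q ^ (N + 2)) 1 = lebesgueSeries q 1 1 := by
  have e (k : ℕ) := lebesgueSeries_sub hq (norm_pow_le_one hq k) norm_one.le
  simp only [← pow_succ, ← pow_add] at e
  induction N with
  | zero =>
    have e0 := e 0
    simp only [pow_zero, zero_add, pow_one, one_mul] at e0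
    rw [spacedGF_one, spacedGF_zero, zero_add, zero_add, pow_one]
    linear_combination -e0
  | succ N ih =>
    rw [spacedGF_add_two, ← ih]
    linear_combination -spacedGF q (N + 1) * e (N + 1)

theorem tsum_spaced {q : ℂ} (hq : ‖q‖ < 1) :
    ∑' l : {l : List (ℕ × Bool) // IsSpaced l}, q ^ (l.1.map Prod.fst).sum =
      lebesgueSeries q 1 1 := by
  have hB : Tendsto (fun N => lebesgueSeries q (q ^ N) 1) atTop (𝓝 1) := by
    have h := tendsto_lebesgueSeries hq (norm_pow_le_one hq) (fun _ => norm_one.le)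
      (tendsto_pow_zero_complex hq) (tendsto_const_nhds (x := (1 : ℂ)))
    rwa [lebesgueSeries_zero_left] at h
  have hT := tendsto_spacedGF hq
  -- As N grows, L(q^N,1) tends to 1 and q^{N+2} kills the second summand.
  have hlim := ((hT.comp (tendsto_add_atTop_nat 1)).mul (hB.comp (tendsto_add_atTop_nat 1))).add
    ((((tendsto_pow_zero_complex hq).comp (tendsto_add_atTop_nat 2)).mul hT).mul
      (hB.comp (tendsto_add_atTop_nat 2)))
  simp only [zero_mul, mul_one, add_zero] at hlim
  exact tendsto_nhds_unique hlim
    (tendsto_const_nhds.congr fun N => (spacedGF_mul_lebesgueSeries hq N).symm)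

theorem theorem3p1 :
    (∀ n : ℕ, rrCountNoRedOne n = lovejoyD 2 1 n) ∧
      ∀ q : ℂ, ‖q‖ < 1 →
        HasSum (fun n : ℕ => (rrCountNoRedOne n : ℂ) * q ^ n)
          (qPochhammerInf (-q) q *
              (qPochhammerInf q (q ^ 4) * qPochhammerInf (q ^ 3) (q ^ 4) *
                qPochhammerInf (q ^ 4) (q ^ 4)) /
            qPochhammerInf q q) := by
  refine ⟨fun n => (rrCountNoRedOne_eq n).trans (lovejoyD_eq n).symm, fun q hq => ?_⟩
  rw [← lebesgueSeries_one_one_eq hq, ← tsum_spaced hq]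
  exact hasSum_rrCountNoRedOne hq
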